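/- Let $V$ be a finite set. For a directed acyclic graph (DAG) $G$ on $V$, let $\mathcal M(G)$ be the set of triples $\langle A,B\mid C\rangle$ of subsets of $V$ such that $C$ separates $A$ from $B$ in the moral graph of the subgraph of $G$ induced on the smallest ancestral set containing $A\cup B\cup C$ (a set is ancestral in $G$ if it contains the parents of each of its elements; $C$ separates $A$ from $B$ if every path, possibly of length zero, from $A$ to $B$ contains an element of $C$). DAGs $G,G'$ are Markov equivalent if $\mathcal M(G)=\mathcal M(G')$. A dagoid is a Markov equivalence class of DAGs on $V$, and $\mathfrak D$ is the (finite) set of dagoids on $V$. For $A\subseteq V$, let $\mathfrak A(A)$ be the set of dagoids $D$ for which $A$ is ancestral in some $G\in D$. For such $D$ and $G$, let $D_A$ be the Markov equivalence class of the induced subgraph $G_A$, and let $D_{V\mid A}$ be the class of the DAG on $V$ obtained from $G$ by replacing the arrows between elements of $A$ by those of a complete DAG on $A$; these classes do not depend on the choices made. A probability distribution $\pi$ on $\mathfrak D$ (a graph law) is structurally Markov if for every $A\subseteq V$ with $\pi(\mathfrak A(A))>0$, the random dagoids $D_{V\mid A}$ and $D_A$ are independent under $\pi(\,\cdot\mid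 \mathfrak A(A))$. Let $X=(X_v)_{v\in V}$ take values in a product $\prod_{v\in V}\mathcal X_v$ of measurable spaces. A family $\vartheta=\{\theta^{(D)}: D\in\mathfrak D\}$ of probability distributions for $X$ is compatible if (i) each $\theta^{(D)}$ is Markov with respect to $D$, that is, $X_A$ and $X_B$ are conditionally independent given $X_C$ under $\theta^{(D)}$ whenever $\langle A,B\mid C\rangle\in\mathcal M(G)$ for $G\in D$; and (ii) for all $D,D'\in\mathfrak D$, all $G\in D$, $G'\in D'$, and every $v\in V$ having the same set of parents $P$ in $G$ and in $G'$, some Markov kernel is a version of the conditional distribution of $X_v$ given $X_P$ under both $\theta^{(D)}$ and $\theta^{(D')}$. **Theorem.** Suppose that $\pi$ is a structurally Markov graph law over $\mathfrak D$ and that $\vartheta$ is a family of compatible distributions. Let $(D,X)$ have the joint distribution under which $D\sim\pi$ and $X\mid D\sim\theta^{(D)}$. Then for almost every $x$ with respect to the marginal distribution of $X$, the posterior graph law of $D$ given $X=x$ is structurally Markov. -/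

import Mathlib

open MeasureTheory ProbabilityTheory

namespace StructMarkov

universe u w

section Graphs

variable {V : Type u}

/-- A directed graph is acyclic if some well-ordering `r` of its vertices is compatible with it,
that is, every arrow goes from a smaller to a larger vertex. -/
def IsAcyclic (G : Digraph V) : Prop :=
  ∃ r : V → V → Prop, IsWellOrder V r ∧ ∀ a b, G.Adj a b → r a b

/-- Directed acyclic graphs with vertex set `V`; `G.Adj a b` is the arrow from `a` to `b`. -/
@[ext]
structure DAG (V : Type u) extends Digraph V where
  acyclic : IsAcyclic toDigraph

namespace DAG

/-- The set of parents of a vertex. -/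
def parents (G : DAG V) (v : V) : Set V := {a | G.Adj a v}

/-- `A` is ancestral in `G` if it contains the parents of each of its elements. -/
def IsAncestral (G : DAG V) (A : Set V) : Prop := ∀ v ∈ A, G.parents v ⊆ A

/-- The smallest ancestral set of `G` that contains `B`. -/
def ancestralHull (G : DAG V) (B : Set V) : Set V := ⋂₀ {S | B ⊆ S ∧ G.IsAncestral S}

/-- The subgraph induced on a set of vertices. -/
def induce (G : DAG V) (A : Set V) : DAG A where
  Adj a b := G.Adj a b
  acyclic := by
    obtain ⟨r, hr, h⟩ := G.acyclic
    exact ⟨Subrel r (· ∈ A), (Subrel.relEmbedding r (· ∈ A)).isWellOrder,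
      fun a b hab => h a b hab⟩

/-- The moral graph: the skeleton, with an edge added between any two vertices that have a common
child. -/
def moral (G : DAG V) : SimpleGraph V where
  Adj a b := a ≠ b ∧ (G.Adj a b ∨ G.Adj b a ∨ ∃ c, G.Adj a c ∧ G.Adj b c)
  symm := ⟨by
    rintro a b ⟨hne, h | h | ⟨c, h₁, h₂⟩⟩
    · exact ⟨hne.symm, Or.inr (Or.inl h)⟩
    · exact ⟨hne.symm, Or.inl h⟩
    · exact ⟨hne.symm, Or.inr (Or.inr ⟨c, h₂, h₁⟩)⟩⟩
  loopless := ⟨fun _ h => h.1 rfl⟩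

end DAG

/-- `A` and `B` are separated by `C` in an undirected graph: every path (possibly of length zero)
from `A` to `B` contains an element of `C`. -/
def Separated (H : SimpleGraph V) (A B C : Set V) : Prop :=
  ∀ a ∈ A, ∀ b ∈ B, ∀ p : H.Walk a b, ∃ c ∈ C, c ∈ p.support

namespace DAG

/-- The semi-graphoid of `G` (its global Markov property): the triples `⟨A, B | C⟩` such that `C`
separates `A` from `B` in the moral graph of the subgraph of `G` induced on the smallest ancestral
set containing `A ∪ B ∪ C`. -/
def semigraphoid (G : DAG V) : Set (Set V × Set V × Set V) :=
  {t | Separated (G.induce (G.ancestralHull (t.1 ∪ t.2.1 ∪ t.2.2))).moral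
    (Subtype.val ⁻¹' t.1) (Subtype.val ⁻¹' t.2.1) (Subtype.val ⁻¹' t.2.2)}

/-- Markov equivalence: equality of semi-graphoids. -/
def markovSetoid (V : Type u) : Setoid (DAG V) := Setoid.ker semigraphoid

/-- A complete directed acyclic graph on `V`: all arrows that respect a well-ordering. (All complete
directed acyclic graphs on `V` are Markov equivalent.) -/
def complete (V : Type u) : DAG V where
  Adj := WellOrderingRel
  acyclic := ⟨WellOrderingRel, inferInstance, fun _ _ h => h⟩

open Classical in
/-- The insertion of a graph `H` on an ancestral set `A` of `G` into `G`: its arrows are those of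
`H`, together with those of `G` that do not join two elements of `A`. -/
def insertion {A : Set V} (H : DAG A) (G : DAG V) (hA : G.IsAncestral A) : DAG V where
  Adj a b := (∃ (ha : a ∈ A) (hb : b ∈ A), H.Adj ⟨a, ha⟩ ⟨b, hb⟩) ∨
    (G.Adj a b ∧ ¬ (a ∈ A ∧ b ∈ A))
  acyclic := by
    obtain ⟨r, hr, h⟩ := G.acyclic
    obtain ⟨s, hs, k⟩ := H.acyclic
    let f : V → A ⊕ V := fun v => if hv : v ∈ A then Sum.inl ⟨v, hv⟩ else Sum.inr v
    have hf : Function.Injective f := by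
      intro a b hab
      by_cases ha : a ∈ A <;> by_cases hb : b ∈ A <;> simp_all [f]
    refine ⟨f ⁻¹'o Sum.Lex s r, (RelEmbedding.preimage ⟨f, hf⟩ (Sum.Lex s r)).isWellOrder, ?_⟩
    rintro a b (⟨ha, hb, hab⟩ | ⟨hab, hn⟩)
    · simpa [Order.Preimage, f, ha, hb] using! k _ _ hab
    · by_cases hb : b ∈ A
      · exact absurd ⟨hA b hb hab, hb⟩ hn
      · by_cases ha : a ∈ A
        · simp [Order.Preimage, f, ha, hb]
        · simpa [Order.Preimage, f, ha, hb] using! h _ _ hab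

lemma insertion_isAncestral {A : Set V} (H : DAG A) (G : DAG V) (hA : G.IsAncestral A) :
    (H.insertion G hA).IsAncestral A := by
  rintro v hv a (⟨ha, -, -⟩ | ⟨h, -⟩)
  · exact ha
  · exact hA v hv h

instance [Finite V] : Finite (DAG V) :=
  Finite.of_injective (fun G : DAG V => G.Adj) fun G G' h => by
    cases G; cases G'; congr; exact Digraph.ext h

instance : Nonempty (DAG V) := ⟨complete V⟩

end DAG

/-- A dagoid on `V` is a Markov equivalence class of directed acyclic graphs on `V`. -/
def Dagoid (V : Type u) : Type u := Quotient (DAG.markovSetoid V)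

/-- The Markov equivalence class of a directed acyclic graph. -/
def DAG.dagoid (G : DAG V) : Dagoid V := Quotient.mk (DAG.markovSetoid V) G

namespace Dagoid

instance [Finite V] : Finite (Dagoid V) := inferInstanceAs (Finite (Quotient _))

instance : Nonempty (Dagoid V) := ⟨(DAG.complete V).dagoid⟩

/-- The discrete σ-algebra. -/
instance : MeasurableSpace (Dagoid V) := ⊤

instance : DiscreteMeasurableSpace (Dagoid V) := ⟨fun _ => trivial⟩

/-- The graph `G` belongs to the equivalence class `D`. -/
instance : Membership (DAG V) (Dagoid V) := ⟨fun D G => G.dagoid = D⟩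

/-- The semi-graphoid shared by all graphs of a dagoid. -/
def semigraphoid (D : Dagoid V) : Set (Set V × Set V × Set V) :=
  Quotient.lift DAG.semigraphoid (fun _ _ h => h) D

/-- The dagoids in which `A` is ancestral, that is, in some graph of which `A` is ancestral. -/
def ances (A : Set V) : Set (Dagoid V) := {D | ∃ G ∈ D, G.IsAncestral A}

/-- The complete dagoid. -/
def complete (V : Type u) : Dagoid V := (DAG.complete V).dagoid

/-- The subdagoid `D_A` induced on an ancestral set `A` of `D`: the class of the induced subgraph
`G_A`, where `G` is a graph of `D` in which `A` is ancestral (the class does not depend on `G`). -/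
noncomputable def induced (A : Set V) (D : ances A) : Dagoid A :=
  (D.2.choose.induce A).dagoid

/-- The insertion of a dagoid `K` on an ancestral set `A` of `D` into `D`: the class of the
insertion of `H` into `G`, where `H` is a graph of `K` and `G` is a graph of `D` in which `A` is
ancestral (the class depends neither on `H` nor on `G`). -/
noncomputable def insertion {A : Set V} (K : Dagoid A) (D : ances A) : Dagoid V :=
  ((Quotient.out K).insertion D.2.choose D.2.choose_spec.2).dagoid

/-- The remainder dagoid `D_{V|A}` of `D` given an ancestral set `A`: the complete dagoid on `A`
inserted into `D`. -/
noncomputable def remainder (A : Set V) (D : ances A) : Dagoid V :=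
  insertion (complete A) D

end Dagoid

/-- A graph law `π` on dagoids is structurally Markov if, for every `A`, the remainder dagoid
`D_{V|A}` and the induced subdagoid `D_A` are independent under the law `π` conditioned on the event
that `A` is ancestral in `D` (there is no condition on `A` if this event is null: the conditioned
measure is then zero). The conditioned law is regarded as a measure on the subtype of dagoids in
which `A` is ancestral, where `D_{V|A}` and `D_A` are defined. -/
def StructurallyMarkov (π : Measure (Dagoid V)) : Prop :=
  ∀ A : Set V, IndepFun (Dagoid.remainder A) (Dagoid.induced A)
    ((ProbabilityTheory.cond π (Dagoid.ances A)).comap Subtype.val)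

end Graphs

section Distributions

variable {V : Type u} {𝓧 : V → Type w} [∀ v, MeasurableSpace (𝓧 v)]

/-- Conditional independence of the subvectors `X_A` and `X_B` given `X_C` under `θ`, where `X` is
the coordinate process on the product space:
`P(X_A ∈ S, X_B ∈ T | X_C) = P(X_A ∈ S | X_C) P(X_B ∈ T | X_C)` almost surely, for all measurable
`S` and `T`. (Mathlib's `CondIndepFun` is the same notion, on standard Borel spaces only.) -/
def CondIndepCoord (θ : Measure (∀ v, 𝓧 v)) (A B C : Set V) : Prop :=
  ∀ (S : Set (∀ v : A, 𝓧 v)) (T : Set (∀ v : B, 𝓧 v)), MeasurableSet S → MeasurableSet T →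
    θ⟦A.domRestrict ⁻¹' S ∩ B.domRestrict ⁻¹' T | MeasurableSpace.pi.comap (C.domRestrict (π := 𝓧))⟧
      =ᵐ[θ] θ⟦A.domRestrict ⁻¹' S | MeasurableSpace.pi.comap (C.domRestrict (π := 𝓧))⟧ *
        θ⟦B.domRestrict ⁻¹' T | MeasurableSpace.pi.comap (C.domRestrict (π := 𝓧))⟧

/-- `θ` is Markov with respect to a set of triples `⟨A, B | C⟩`. -/
def IsMarkov (M : Set (Set V × Set V × Set V)) (θ : Measure (∀ v, 𝓧 v)) : Prop :=
  ∀ A B C : Set V, (A, B, C) ∈ M → CondIndepCoord θ A B C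

/-- The kernel `κ` is a version of the conditional probability distribution of `X_v` given `X_S`
under `θ`. -/
def IsCondVersion (θ : Measure (∀ v, 𝓧 v)) (S : Set V) (v : V)
    (κ : Kernel (∀ a : S, 𝓧 a) (𝓧 v)) : Prop :=
  IsMarkovKernel κ ∧ (θ.map S.domRestrict) ⊗ₘ κ = θ.map (fun x => (S.domRestrict x, x v))

/-- Graph compatibility: for every vertex `v` with the same parents in `G` and `G'`, there is a
common version of the conditional distributions of `X_v` given its parents under `θ` and `θ'`. -/
def GraphCompatible (G G' : DAG V) (θ θ' : Measure (∀ v, 𝓧 v)) : Prop :=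
  ∀ v, G.parents v = G'.parents v →
    ∃ κ : Kernel (∀ a : G.parents v, 𝓧 a) (𝓧 v),
      IsCondVersion θ (G.parents v) v κ ∧ IsCondVersion θ' (G.parents v) v κ

/-- Dagoid compatibility: graph compatibility for every pair of graphs in the two dagoids. -/
def DagoidCompatible (D D' : Dagoid V) (θ θ' : Measure (∀ v, 𝓧 v)) : Prop :=
  ∀ G ∈ D, ∀ G' ∈ D', GraphCompatible G G' θ θ'

/-- A family of compatible distributions indexed by the dagoids on `V`: the member at `D` is Markov
with respect to `D`, and the members are pairwise compatible. -/
structure CompatibleFamily (θ : Dagoid V → ProbabilityMeasure (∀ v, 𝓧 v)) : Prop where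
  isMarkov : ∀ D, IsMarkov D.semigraphoid (θ D : Measure (∀ v, 𝓧 v))
  compatible : ∀ D D', DagoidCompatible D D' (θ D : Measure (∀ v, 𝓧 v)) (θ D')

/-- The sampling kernel: given the dagoid `D`, the data have distribution `θ D`. -/
noncomputable def samplingKernel [Finite V] (θ : Dagoid V → ProbabilityMeasure (∀ v, 𝓧 v)) :
    Kernel (Dagoid V) (∀ v, 𝓧 v) :=
  Kernel.ofFunOfCountable (fun D => (θ D : Measure (∀ v, 𝓧 v)))

instance [Finite V] (θ : Dagoid V → ProbabilityMeasure (∀ v, 𝓧 v)) :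
    IsMarkovKernel (samplingKernel θ) :=
  ⟨fun D => inferInstanceAs (IsProbabilityMeasure (θ D : Measure (∀ v, 𝓧 v)))⟩

end Distributions

end StructMarkov

/-! Fix `A`. For dagoids in which `A` is ancestral, independence of the remainder and the part on
`A` is, up to normalization, a cross-product identity between cell masses (`CrossIndep`). It
survives reweighting by any density φ with φ(D₁)φ(D₂) = φ(D₃)φ(D₄) whenever D₃, D₄ arise from D₁, D₂
by exchanging the parts on `A` (`CrossIndep.withDensity`). By Bayes the posterior is the prior
reweighted by the likelihood, so it suffices that the likelihood has this property for almost every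
x (`CompatibleFamily.ae_rnDeriv_mul_eq`).

Informally, p(x | D) = p(x_A | D_A) p(x_{V∖A} | x_A, D_{V|A}). Precisely, the law of X_A depends on
D_A only (`map_eq_of_induced_eq`), and two dagoids with the same remainder have a likelihood ratio
that depends on x_A only (`eq_withDensity_of_remainder_eq`). Both are proved by adding one vertex at
a time to an ancestral set, with transition kernels shared by compatibility.

Sharing kernels requires representatives with equal parents inside, respectively outside, `A`. They
exist because insertion respects Markov equivalence, which follows from the local-to-global Markov
property (`splits_of_forall_local`). -/

namespace StructMarkov

universe u w

/-! ### Separation as splitting, and its semi-graphoid rules -/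

namespace DAG

variable {V : Type u}

/-- A vertex together with its parents. -/
def family (G : DAG V) (v : V) : Set V := insert v (G.parents v)

/-- Splitting criterion for separation: two sets `X ⊇ A` and `Y ⊇ B` meet in `C`, and every family
of a vertex of `X ∪ Y` is contained in one of them. -/
def Splits (G : DAG V) (A B C : Set V) : Prop :=
  ∃ X Y : Set V, A ⊆ X ∧ B ⊆ Y ∧ X ∩ Y = C ∧ ∀ w ∈ X ∪ Y, G.family w ⊆ X ∨ G.family w ⊆ Y

lemma mem_family_self (G : DAG V) (v : V) : v ∈ G.family v := Set.mem_insert _ _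

lemma mem_family_of_adj {G : DAG V} {a v : V} (h : G.Adj a v) : a ∈ G.family v :=
  Set.mem_insert_of_mem _ h

lemma family_subset_iff {G : DAG V} {v : V} {X : Set V} :
    G.family v ⊆ X ↔ v ∈ X ∧ G.parents v ⊆ X := Set.insert_subset_iff

lemma subset_ancestralHull (G : DAG V) (B : Set V) : B ⊆ G.ancestralHull B :=
  Set.subset_sInter fun _ hS => hS.1

lemma ancestralHull_isAncestral (G : DAG V) (B : Set V) : G.IsAncestral (G.ancestralHull B) :=
  fun v hv _ ha S hS => hS.2 v (hv S hS) ha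

lemma ancestralHull_subset {G : DAG V} {B S : Set V} (h : B ⊆ S) (hS : G.IsAncestral S) :
    G.ancestralHull B ⊆ S := Set.sInter_subset_of_mem ⟨h, hS⟩

lemma exists_mem_family_of_moral {G : DAG V} {S : Set V} {a b : S}
    (h : (G.induce S).moral.Adj a b) :
    ∃ w ∈ S, (a : V) ∈ G.family w ∧ (b : V) ∈ G.family w := by
  obtain ⟨-, h | h | ⟨c, h, k⟩⟩ := h
  · exact ⟨b, b.2, mem_family_of_adj h, mem_family_self _ _⟩
  · exact ⟨a, a.2, mem_family_self _ _, mem_family_of_adj h⟩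
  · exact ⟨c, c.2, mem_family_of_adj h, mem_family_of_adj k⟩

lemma moral_of_mem_family {G : DAG V} {S : Set V} {a b : S} {w : V} (hw : w ∈ S)
    (ha : (a : V) ∈ G.family w) (hb : (b : V) ∈ G.family w) (hab : a ≠ b) :
    (G.induce S).moral.Adj a b := by
  refine ⟨hab, ?_⟩
  rcases ha with ha | ha <;> rcases hb with hb | hb
  · exact absurd (Subtype.ext (ha.trans hb.symm)) hab
  · right; left; change G.Adj b a; rw [ha]; exact hb
  · left; change G.Adj a b; rw [hb]; exact ha
  · right; right; exact ⟨⟨w, hw⟩, ha, hb⟩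

/-- `X ∪ Y` is ancestral, so it contains the hull. The ends of a moral edge lie in one family, so no
edge joins `X \ Y` to `Y \ X`, and a path from `X` to `Y` must meet `X ∩ Y`. -/
lemma Splits.mem_semigraphoid {G : DAG V} {A B C : Set V} (h : G.Splits A B C) :
    (A, B, C) ∈ G.semigraphoid := by
  obtain ⟨X, Y, hA, hB, hC, hF⟩ := h
  have hanc : G.IsAncestral (X ∪ Y) := fun v hv a ha => by
    rcases hF v hv with h | h
    · exact Or.inl (h (mem_family_of_adj ha))
    · exact Or.inr (h (mem_family_of_adj ha))
  have hsub : G.ancestralHull (A ∪ B ∪ C) ⊆ X ∪ Y :=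
    ancestralHull_subset (by grind) hanc
  have key : ∀ (a b : G.ancestralHull (A ∪ B ∪ C))
      (p : (G.induce (G.ancestralHull (A ∪ B ∪ C))).moral.Walk a b), (a : V) ∈ X → (b : V) ∈ Y →
        ∃ c ∈ (Subtype.val ⁻¹' C : Set (G.ancestralHull (A ∪ B ∪ C))), c ∈ p.support := by
    intro a b p
    induction p with
    | @nil u =>
      exact fun ha hb => ⟨u, hC.subset ⟨ha, hb⟩, by simp⟩
    | @cons a c b hac p ih =>
      intro ha hb
      by_cases haY : (a : V) ∈ Y
      · exact ⟨a, hC.subset ⟨ha, haY⟩, by simp⟩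
      · obtain ⟨w, hw, haw, hcw⟩ := exists_mem_family_of_moral hac
        have hcX : (c : V) ∈ X := by
          rcases hF w (hsub hw) with h | h
          · exact h hcw
          · exact absurd (h haw) haY
        obtain ⟨d, hd, hdp⟩ := ih hcX hb
        exact ⟨d, hd, by simp [hdp]⟩
  exact fun a ha b hb p => key a b p (hA ha) (hB hb)

lemma splits_of_mem_semigraphoid {G : DAG V} {A B C : Set V}
    (h : (A, B, C) ∈ G.semigraphoid) : G.Splits A B C := by
  set S := G.ancestralHull (A ∪ B ∪ C) with hS
  have hsub : A ∪ B ∪ C ⊆ S := G.subset_ancestralHull _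
  have hanc : G.IsAncestral S := G.ancestralHull_isAncestral _
  -- The vertices reached from `A` off `C`. A family is a clique of the moral graph, so one that
  -- meets `Z` lies in `Z ∪ C`.
  let Z : Set V := {v | ∃ hv : v ∈ S, ∃ a : S, (a : V) ∈ A ∧
    ∃ p : (G.induce S).moral.Walk a ⟨v, hv⟩, ∀ c ∈ p.support, (c : V) ∉ C}
  have hZC : ∀ v ∈ Z, v ∉ C := by
    rintro v ⟨hv, a, ha, p, hp⟩
    exact hp _ p.end_mem_support
  refine ⟨Z ∪ C, (S \ Z) ∪ C, ?_, ?_, ?_, ?_⟩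
  · intro a ha
    by_cases haC : a ∈ C
    · exact Or.inr haC
    · exact Or.inl ⟨hsub (by grind), ⟨a, hsub (by grind)⟩, ha, .nil, by simpa using haC⟩
  · intro b hb
    refine Or.inl ⟨hsub (by grind), ?_⟩
    rintro ⟨hv, a, ha, p, hp⟩
    obtain ⟨c, hc, hcp⟩ := h a ha ⟨b, hv⟩ hb p
    exact hp c hcp hc
  · grind
  · intro w hw
    have hwS : w ∈ S := by
      rcases hw with (⟨h, -⟩ | h) | (h | h)
      · exact h
      · exact hsub (by grind)
      · exact h.1
      · exact hsub (by grind)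
    have hfam : G.family w ⊆ S := family_subset_iff.2 ⟨hwS, hanc w hwS⟩
    by_cases hex : ∃ z ∈ G.family w, z ∈ Z
    · left
      obtain ⟨z, hzw, hz⟩ := hex
      intro y hy
      by_cases hyC : y ∈ C
      · exact Or.inr hyC
      · left
        by_cases hyz : y = z
        · exact hyz ▸ hz
        · obtain ⟨hzS, a, ha, p, hp⟩ := hz
          have hadj : (G.induce S).moral.Adj ⟨z, hzS⟩ ⟨y, hfam hy⟩ :=
            moral_of_mem_family hwS hzw hy (by simpa using fun h => hyz h.symm)
          refine ⟨hfam hy, a, ha, p.concat hadj, ?_⟩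
          intro c hc
          rw [SimpleGraph.Walk.support_concat] at hc
          simp only [List.mem_append, List.mem_singleton] at hc
          rcases hc with hc | rfl
          · exact hp c hc
          · exact hyC
    · right
      intro y hy
      exact Or.inl ⟨hfam hy, fun hz => hex ⟨y, hy, hz⟩⟩

lemma mem_semigraphoid_iff {G : DAG V} {A B C : Set V} :
    (A, B, C) ∈ G.semigraphoid ↔ G.Splits A B C :=
  ⟨splits_of_mem_semigraphoid, Splits.mem_semigraphoid⟩

lemma dagoid_eq_iff {G G' : DAG V} :
    G.dagoid = G'.dagoid ↔ ∀ A B C, G.Splits A B C ↔ G'.Splits A B C := by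
  refine Quotient.eq.trans ?_
  change G.semigraphoid = G'.semigraphoid ↔ _
  simp only [← mem_semigraphoid_iff]
  exact ⟨fun h A B C => by rw [h], fun h => Set.ext fun ⟨A, B, C⟩ => h A B C⟩

namespace Splits

variable {G : DAG V} {A A' B B' C E : Set V}

lemma symm (h : G.Splits A B C) : G.Splits B A C := by
  obtain ⟨X, Y, hA, hB, hC, hF⟩ := h
  exact ⟨Y, X, hB, hA, by rw [Set.inter_comm, hC], fun w hw => (hF w hw.symm).symm⟩

lemma mono (h : G.Splits A B C) (hA' : A' ⊆ A) (hB' : B' ⊆ B) : G.Splits A' B' C := by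
  obtain ⟨X, Y, hA, hB, hC, hF⟩ := h
  exact ⟨X, Y, hA'.trans hA, hB'.trans hB, hC, hF⟩

lemma union_given (h : G.Splits A B C) : G.Splits (A ∪ C) (B ∪ C) C := by
  obtain ⟨X, Y, hA, hB, rfl, hF⟩ := h
  exact ⟨X, Y, by grind, by grind, rfl, hF⟩

lemma weak_union (h : G.Splits A B C) (hE : E ⊆ B) : G.Splits A B (C ∪ E) := by
  obtain ⟨X, Y, hA, hB, rfl, hF⟩ := h
  have hEY := hE.trans hB
  refine ⟨X ∪ E, Y, by grind, hB, by grind, fun w hw => ?_⟩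
  rcases hF w (by grind) with h | h
  · exact Or.inl (h.trans Set.subset_union_left)
  · exact Or.inr h

lemma contraction (h₁ : G.Splits A B C) (h₂ : G.Splits A E (B ∪ C)) :
    G.Splits A (B ∪ E) C := by
  obtain ⟨X₁, Y₁, hA₁, hB₁, hC₁, hF₁⟩ := h₁
  obtain ⟨X₂, Y₂, hA₂, hE₂, hC₂, hF₂⟩ := h₂
  have hB : B ⊆ X₂ ∩ Y₂ := hC₂ ▸ Set.subset_union_left
  have hC : C ⊆ X₂ ∩ Y₂ := hC₂ ▸ Set.subset_union_right
  have hCX : C ⊆ X₁ ∩ Y₁ := hC₁.symm.subset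
  -- The second splitting sorts first: a family inside `Y₂` is settled, and one inside `X₂` is then
  -- sorted by the first splitting.
  refine ⟨X₁ ∩ X₂, Y₂ ∪ (Y₁ ∩ X₂), by grind, by grind, by grind, fun w hw => ?_⟩
  have hF₁' : w ∈ X₁ ∪ Y₁ → G.family w ⊆ X₂ →
      G.family w ⊆ X₁ ∩ X₂ ∨ G.family w ⊆ Y₂ ∪ (Y₁ ∩ X₂) := by
    intro h h'
    rcases hF₁ w h with h | h
    · exact Or.inl (Set.subset_inter h h')
    · exact Or.inr ((Set.subset_inter h h').trans Set.subset_union_right)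
  rcases hF₂ w (by grind) with h | h
  · have := h (G.mem_family_self w)
    exact hF₁' (by grind) h
  · exact Or.inr (h.trans Set.subset_union_left)

lemma anti {G' : DAG V} (h : G.Splits A B C) (hG : ∀ v, G'.parents v ⊆ G.parents v) :
    G'.Splits A B C := by
  obtain ⟨X, Y, hA, hB, hC, hF⟩ := h
  exact ⟨X, Y, hA, hB, hC, fun w hw => (hF w hw).imp
    (Set.Subset.trans (Set.insert_subset_insert (hG w)))
    (Set.Subset.trans (Set.insert_subset_insert (hG w)))⟩

end Splits

lemma splits_self_right (G : DAG V) (A B : Set V) : G.Splits A B B :=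
  ⟨Set.univ, B, Set.subset_univ _, subset_rfl, Set.univ_inter _,
    fun _ _ => Or.inl (Set.subset_univ _)⟩

lemma splits_of_isAncestral {G : DAG V} {v : V} {P : Set V} (hP : G.IsAncestral P) (hv : v ∉ P)
    (h : G.parents v ⊆ P) : G.Splits {v} P (G.parents v) := by
  refine ⟨G.family v, P, by simp [mem_family_self], subset_rfl, ?_, fun w hw => ?_⟩
  · rw [family, Set.insert_inter_of_notMem hv, Set.inter_eq_left.2 h]
  · by_cases hwP : w ∈ P
    · exact Or.inr (family_subset_iff.2 ⟨hwP, hP w hwP⟩)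
    · left
      rcases hw with (rfl | hw) | hw
      · exact subset_rfl
      · exact absurd (h hw) hwP
      · exact absurd hw hwP

/-! ### From the local to the global Markov property -/

/-- The ordered local Markov property implies the global Markov property. -/
lemma splits_of_forall_local [Finite V] {G G' : DAG V} (f : V → ℕ) (hf : Function.Injective f)
    (hG : ∀ a b, G.Adj a b → f a < f b)
    (hloc : ∀ v, G'.Splits {v} {u | f u < f v} (G.parents v)) {A B C : Set V}
    (h : G.Splits A B C) : G'.Splits A B C := by
  -- Induction on the size of `X ∪ Y`, removing its `f`-largest vertex `v`, whose family lies in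
  -- `X`, say. The local property at `v` and weak union separate `v` from `Y \ {v}` given `X \ {v}`;
  -- contraction with the induction hypothesis puts `v` back.
  have key : ∀ n : ℕ, ∀ X Y : Set V, (X ∪ Y).ncard = n →
      (∀ w ∈ X ∪ Y, G.family w ⊆ X ∨ G.family w ⊆ Y) → G'.Splits X Y (X ∩ Y) := by
    intro n
    induction n with
    | zero =>
      intro X Y hn _
      rw [Set.ncard_eq_zero (Set.toFinite _), Set.union_empty_iff] at hn
      rw [hn.1, hn.2, Set.empty_inter]
      exact G'.splits_self_right _ _
    | succ n ih =>
      have main : ∀ X Y : Set V, (X ∪ Y).ncard = n + 1 →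
          (∀ w ∈ X ∪ Y, G.family w ⊆ X ∨ G.family w ⊆ Y) → ∀ v, G.family v ⊆ X →
          (∀ u ∈ X ∪ Y, u ≠ v → f u < f v) → G'.Splits X Y (X ∩ Y) := by
        intro X Y hn hF v hvX hmax
        have hv : v ∈ X := hvX (G.mem_family_self v)
        have hpv : v ∉ G.parents v := fun h => lt_irrefl _ (hG v v h)
        have hpX : G.parents v ⊆ X \ {v} := fun u hu =>
          ⟨hvX (mem_family_of_adj hu), fun h => hpv (h ▸ hu)⟩
        have hun : X \ {v} ∪ Y \ {v} = (X ∪ Y) \ {v} := by grind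
        have hin : X \ {v} ∩ (Y \ {v}) = (X ∩ Y) \ {v} := by grind
        have hIH : G'.Splits (X \ {v}) (Y \ {v}) ((X ∩ Y) \ {v}) := by
          rw [← hin]
          refine ih _ _ ?_ ?_
          · rw [hun, Set.ncard_sdiff_singleton_of_mem (Set.mem_union_left _ hv), hn]; rfl
          · intro w hw
            have hw' : w ∈ X ∪ Y := by grind
            have hvw : v ∉ G.family w := by
              rintro (h | h)
              · grind
              · exact lt_asymm (hG v w h) (hmax w hw' (by grind))
            exact (hF w hw').imp (fun h => Set.subset_sdiff_singleton h hvw)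
              (fun h => Set.subset_sdiff_singleton h hvw)
        have hl : G'.Splits {v} (X \ {v} ∪ Y \ {v}) (X \ {v}) := by
          have h₁ : G'.Splits {v} (X \ {v} ∪ Y \ {v}) (G.parents v) :=
            (hloc v).mono subset_rfl (fun u hu => hmax u (by grind) (by grind))
          have h₂ := h₁.weak_union (E := X \ {v}) Set.subset_union_left
          rwa [Set.union_eq_right.2 hpX] at h₂
        have hl' : G'.Splits (Y \ {v}) {v} (X \ {v} ∪ (X ∩ Y) \ {v}) := by
          rw [Set.union_eq_left.2 (by grind)]
          exact (hl.mono subset_rfl Set.subset_union_right).symm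
        have hc := hIH.symm.contraction hl'
        rw [Set.sdiff_union_self, Set.union_eq_left.2 (by simpa using hv)] at hc
        -- If `v` is also in `Y` it belongs to the separator, and weak union moves it there.
        by_cases hvY : v ∈ Y
        · have h₁ := (hc.weak_union (E := {v}) (by simpa using hv)).union_given
          have hvC : {v} ⊆ X ∩ Y := Set.singleton_subset_iff.2 ⟨hv, hvY⟩
          rw [Set.sdiff_union_self, Set.union_eq_left.2 hvC] at h₁
          refine h₁.symm.mono Set.subset_union_left fun y hy => ?_
          by_cases hyv : y = v
          · exact Or.inr (hyv ▸ ⟨hv, hvY⟩)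
          · exact Or.inl ⟨hy, hyv⟩
        · have h₁ : Y \ {v} = Y := Set.sdiff_singleton_eq_self hvY
          have h₂ : (X ∩ Y) \ {v} = X ∩ Y := Set.sdiff_singleton_eq_self (fun h => hvY h.2)
          rw [h₁, h₂] at hc
          exact hc.symm
      intro X Y hn hF
      obtain ⟨v, hv, hmax⟩ := Set.exists_max_image (X ∪ Y) f (Set.toFinite _)
        (Set.nonempty_of_ncard_ne_zero (by omega))
      have hmax' : ∀ u ∈ X ∪ Y, u ≠ v → f u < f v := fun u hu huv =>
        lt_of_le_of_ne (hmax u hu) (fun h => huv (hf h))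
      rcases hF v hv with h | h
      · exact main X Y hn hF v h hmax'
      · rw [Set.inter_comm]
        rw [Set.union_comm] at hn
        exact (main Y X hn (fun w hw => (hF w hw.symm).symm) v h
          (fun u hu => hmax' u hu.symm)).symm
  obtain ⟨X, Y, hA, hB, rfl, hF⟩ := h
  exact (key _ X Y rfl hF).mono hA hB

lemma exists_rank [Finite V] {G : DAG V} {A : Set V} (hA : G.IsAncestral A) :
    ∃ f : V → ℕ, Function.Injective f ∧ (∀ a b, G.Adj a b → f a < f b) ∧
      ∀ a ∈ A, ∀ b ∉ A, f a < f b := by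
  classical
  obtain ⟨r, hr, h⟩ := G.acyclic
  let _ : LinearOrder V := IsWellOrder.linearOrder r
  let f : V → ℕ := fun v => (Set.Iio v).ncard
  have hf : StrictMono f := fun a b hab =>
    Set.ncard_lt_ncard (Set.Iio_ssubset_Iio hab) (Set.toFinite _)
  have hlt : ∀ v, f v < Nat.card V := fun v => by
    rw [← Set.ncard_univ]
    exact Set.ncard_lt_ncard (Set.ssubset_univ_iff.2 fun h =>
      lt_irrefl v (h.symm.subset (Set.mem_univ v))) (Set.toFinite _)
  -- The shift by `Nat.card V` numbers `A` first; since `A` is ancestral, no arrow enters `A` from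
  -- outside.
  refine ⟨fun v => if v ∈ A then f v else f v + Nat.card V, ?_, ?_, ?_⟩
  · intro a b hab
    have h₁ := hlt a
    have h₂ := hlt b
    apply hf.injective
    by_cases ha : a ∈ A <;> by_cases hb : b ∈ A <;> simp only [ha, hb, if_true, if_false] at hab <;>
      omega
  · intro a b hab
    have h₁ := hf (show a < b from h a b hab)
    have h₂ := hlt a
    by_cases hb : b ∈ A
    · simpa [hA b hb hab, hb] using h₁
    · by_cases ha : a ∈ A <;> simp only [ha, hb, if_true, if_false] <;> omega
  · intro a ha b hb
    have h₁ := hlt a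
    simp only [ha, hb, if_true, if_false]
    omega

/-! ### Insertion respects Markov equivalence -/

variable {A : Set V} {H H' : DAG A} {G G' : DAG V} {hA : G.IsAncestral A} {hA' : G'.IsAncestral A}

lemma insertion_parents_of_mem {v : V} (hv : v ∈ A) :
    (H.insertion G hA).parents v = Subtype.val '' H.parents ⟨v, hv⟩ := by
  ext a
  constructor
  · rintro (⟨ha, _, h⟩ | ⟨h, hn⟩)
    · exact ⟨⟨a, ha⟩, h, rfl⟩
    · exact absurd ⟨hA v hv h, hv⟩ hn
  · rintro ⟨b, hb, rfl⟩
    exact Or.inl ⟨b.2, hv, hb⟩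

lemma insertion_parents_of_notMem {v : V} (hv : v ∉ A) :
    (H.insertion G hA).parents v = G.parents v := by
  ext a
  constructor
  · rintro (⟨_, h, _⟩ | ⟨h, -⟩)
    · exact absurd h hv
    · exact h
  · exact fun h => Or.inr ⟨h, fun h' => hv h'.2⟩

lemma insertion_parents_congr {v : V} (hv : v ∉ A) :
    (H.insertion G hA).parents v = (H'.insertion G hA).parents v := by
  rw [insertion_parents_of_notMem hv, insertion_parents_of_notMem hv]

lemma insertion_induce (hA : G.IsAncestral A) : (G.induce A).insertion G hA = G := by
  apply DAG.ext
  ext a b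
  constructor
  · rintro (⟨_, _, h⟩ | ⟨h, -⟩)
    · exact h
    · exact h
  · intro h
    by_cases hab : a ∈ A ∧ b ∈ A
    · exact Or.inl ⟨hab.1, hab.2, h⟩
    · exact Or.inr ⟨h, hab⟩

lemma Splits.insertion {B C E : Set A} (h : H.Splits B C E) (hA : G.IsAncestral A) :
    (H.insertion G hA).Splits (Subtype.val '' B) (Subtype.val '' C) (Subtype.val '' E) := by
  obtain ⟨X, Y, hB, hC, rfl, hF⟩ := h
  refine ⟨Subtype.val '' X, Subtype.val '' Y, Set.image_mono hB, Set.image_mono hC,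
    (Set.image_inter Subtype.val_injective).symm, ?_⟩
  rw [← Set.image_union]
  rintro _ ⟨w, hw, rfl⟩
  have : (H.insertion G hA).family w = Subtype.val '' H.family w := by
    rw [family, insertion_parents_of_mem w.2, family, Set.image_insert_eq]
  rw [this]
  exact (hF w hw).imp Set.image_mono Set.image_mono

/-- Local-to-global along a ranking that puts `A` first. The predecessors of a vertex of `A` lie in
`A`, where `hH` applies, so only vertices outside `A` remain to be checked, against sets `P ⊇ A`. -/
lemma splits_insertion_of_forall [Finite V] (hH : ∀ B C E, H.Splits B C E → H'.Splits B C E)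
    (hG : ∀ v ∉ A, ∀ P, A ⊆ P → (H.insertion G hA).IsAncestral P → v ∉ P → G.parents v ⊆ P →
      (H'.insertion G' hA').Splits {v} P (G.parents v)) {B C E : Set V}
    (h : (H.insertion G hA).Splits B C E) : (H'.insertion G' hA').Splits B C E := by
  obtain ⟨f, hf, hlt, hfA⟩ := exists_rank (insertion_isAncestral H G hA)
  have hP : ∀ v, (H.insertion G hA).IsAncestral {u | f u < f v} :=
    fun v u hu a ha => (hlt a u ha).trans hu
  have hpar : ∀ v, (H.insertion G hA).parents v ⊆ {u | f u < f v} := fun v u hu => hlt u v hu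
  refine splits_of_forall_local f hf hlt (fun v => ?_) h
  by_cases hv : v ∈ A
  · have h₁ : H.Splits {⟨v, hv⟩} {u | f u < f v} (H.parents ⟨v, hv⟩) := by
      refine splits_of_isAncestral (fun u hu a ha => ?_) (fun h => lt_irrefl (f v) h)
        (fun a ha => ?_)
      · exact hP v u hu (Or.inl ⟨a.2, u.2, ha⟩)
      · exact hpar v (Or.inl ⟨a.2, hv, ha⟩)
    have h₂ := (hH _ _ _ h₁).insertion hA'
    rw [← insertion_parents_of_mem (G := G) (hA := hA) hv, Set.image_singleton] at h₂
    refine h₂.mono subset_rfl fun u hu => ?_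
    have huA : u ∈ A := by
      by_contra hu'
      exact lt_asymm (hfA v hv u hu') hu
    exact ⟨⟨u, huA⟩, hu, rfl⟩
  · rw [insertion_parents_of_notMem hv]
    refine hG v hv _ (fun a ha => hfA a ha v hv) (hP v)
      (fun h => lt_irrefl (f v) h) ?_
    rw [← insertion_parents_of_notMem (H := H) (hA := hA) hv]
    exact hpar v

lemma splits_insertion_congr_left [Finite V] (hH : ∀ B C E, H.Splits B C E → H'.Splits B C E)
    {B C E : Set V} (h : (H.insertion G hA).Splits B C E) : (H'.insertion G hA).Splits B C E := by
  refine splits_insertion_of_forall hH (fun v hv P hAP hP hvP hpP => ?_) h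
  rw [← insertion_parents_of_notMem (H := H') (hA := hA) hv] at hpP ⊢
  refine splits_of_isAncestral (fun u hu => ?_) hvP hpP
  by_cases huA : u ∈ A
  · exact (insertion_isAncestral H' G hA u huA).trans hAP
  · rw [insertion_parents_congr (H' := H) huA]
    exact hP u hu

/-- The complete directed acyclic graph given by a well-ordering. -/
def ofWellOrder (r : V → V → Prop) (hr : IsWellOrder V r) : DAG V where
  Adj := r
  acyclic := ⟨r, hr, fun _ _ h => h⟩

/-- The parents of a vertex in a complete graph are all its predecessors, so its local Markov
property is vacuous in any graph. -/
lemma Splits.of_ofWellOrder [Finite V] {r : V → V → Prop} {hr : IsWellOrder V r} {B C E : Set V}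
    (h : (ofWellOrder r hr).Splits B C E) (G : DAG V) : G.Splits B C E := by
  obtain ⟨f, hf, hlt, -⟩ := exists_rank (G := ofWellOrder r hr) (A := Set.univ)
    (fun _ _ => Set.subset_univ _)
  refine splits_of_forall_local f hf hlt (fun v => ?_) h
  have : (ofWellOrder r hr).parents v = {u | f u < f v} := by
    refine Set.Subset.antisymm (fun u hu => hlt u v hu) fun u hu => ?_
    rcases trichotomous_of r u v with h | h | h
    · exact h
    · subst h
      exact (lt_irrefl (f u) hu).elim
    · exact absurd (hlt v u h) (lt_asymm hu)
  rw [this]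
  exact splits_self_right _ _ _

lemma exists_ofWellOrder (H : DAG V) :
    ∃ r, ∃ hr : IsWellOrder V r, ∀ v, H.parents v ⊆ (ofWellOrder r hr).parents v := by
  obtain ⟨r, hr, h⟩ := H.acyclic
  exact ⟨r, hr, fun v a ha => h a v ha⟩

/-- As `P ⊇ A`, the separation of `v` from `P` by its parents ignores the arrows within `A`. It can
thus be read with `K` on `A` and transferred by `hG`; then `K` is exchanged for a complete graph
containing `H'`, and deleting arrows leaves `H'`. -/
lemma splits_insertion_of_complete [Finite V] {K : DAG A} (hK : K ∈ Dagoid.complete A)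
    (hH : ∀ B C E, H.Splits B C E → H'.Splits B C E)
    (hG : ∀ B C E, (K.insertion G hA).Splits B C E → (K.insertion G' hA').Splits B C E)
    {B C E : Set V} (h : (H.insertion G hA).Splits B C E) :
    (H'.insertion G' hA').Splits B C E := by
  refine splits_insertion_of_forall hH (fun v hv P hAP hP hvP hpP => ?_) h
  have hK' : ∀ {B C E : Set A}, K.Splits B C E → ∀ K' : DAG A, K'.Splits B C E := by
    intro B C E h K'
    exact Splits.of_ofWellOrder (hr := inferInstance) ((dagoid_eq_iff.1 hK B C E).1 h) K'
  obtain ⟨r, hr, hsub⟩ := exists_ofWellOrder H'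
  have h₁ : (K.insertion G hA).Splits {v} P (G.parents v) := by
    rw [← insertion_parents_of_notMem (H := K) (hA := hA) hv] at hpP ⊢
    refine splits_of_isAncestral (fun u hu => ?_) hvP hpP
    by_cases huA : u ∈ A
    · exact (insertion_isAncestral K G hA u huA).trans hAP
    · rw [insertion_parents_congr (H' := H) huA]
      exact hP u hu
  have h₂ : ((ofWellOrder r hr).insertion G' hA').Splits {v} P (G.parents v) :=
    splits_insertion_congr_left (fun B C E h => hK' h _) (hG _ _ _ h₁)
  refine h₂.anti fun u => ?_
  by_cases hu : u ∈ A
  · rw [insertion_parents_of_mem hu, insertion_parents_of_mem hu]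
    exact Set.image_mono (hsub _)
  · exact (insertion_parents_congr hu).subset

lemma dagoid_insertion_congr_left [Finite V] (hA : G.IsAncestral A) (h : H.dagoid = H'.dagoid) :
    (H.insertion G hA).dagoid = (H'.insertion G hA).dagoid := by
  rw [dagoid_eq_iff] at h ⊢
  exact fun B C E => ⟨splits_insertion_congr_left fun _ _ _ => (h _ _ _).1,
    splits_insertion_congr_left fun _ _ _ => (h _ _ _).2⟩

lemma dagoid_insertion_congr_right [Finite V] {K : DAG A} (hK : K ∈ Dagoid.complete A) (H : DAG A)
    (h : (K.insertion G hA).dagoid = (K.insertion G' hA').dagoid) :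
    (H.insertion G hA).dagoid = (H.insertion G' hA').dagoid := by
  rw [dagoid_eq_iff] at h ⊢
  exact fun B C E => ⟨splits_insertion_of_complete hK (fun _ _ _ => id) fun _ _ _ => (h _ _ _).1,
    splits_insertion_of_complete hK (fun _ _ _ => id) fun _ _ _ => (h _ _ _).2⟩

end DAG

/-! ### Representatives with common parents -/

namespace Dagoid

variable {V : Type u} {A : Set V}

/-- Two dagoids with the same subdagoid on `A` contain graphs with the same parents of the elements
of `A`. -/
lemma exists_parents_eq_of_induced_eq [Finite V] (D D' : ances A)
    (h : induced A D = induced A D') :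
    ∃ G ∈ D.1, ∃ G' ∈ D'.1, G.IsAncestral A ∧ ∀ v ∈ A, G.parents v = G'.parents v := by
  have hD := D.2.choose_spec
  have hD' := D'.2.choose_spec
  refine ⟨(D'.2.choose.induce A).insertion D.2.choose hD.2, ?_, D'.2.choose, hD'.1,
    DAG.insertion_isAncestral _ _ _, fun v hv => ?_⟩
  · refine (DAG.dagoid_insertion_congr_left hD.2 h.symm).trans ?_
    rw [DAG.insertion_induce]
    exact hD.1
  · rw [DAG.insertion_parents_of_mem hv, ← DAG.insertion_parents_of_mem (hA := hD'.2) hv,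
      DAG.insertion_induce]

/-- Two dagoids with the same remainder given `A` contain graphs in which `A` is ancestral, with the
same parents of the elements outside `A`. -/
lemma exists_parents_eq_of_remainder_eq [Finite V] (D D' : ances A)
    (h : remainder A D = remainder A D') :
    ∃ G ∈ D.1, ∃ G' ∈ D'.1, G.IsAncestral A ∧ G'.IsAncestral A ∧
      ∀ v ∉ A, G.parents v = G'.parents v := by
  have hD := D.2.choose_spec
  have hD' := D'.2.choose_spec
  refine ⟨(D.2.choose.induce A).insertion D'.2.choose hD'.2, ?_, D'.2.choose, hD'.1,
    DAG.insertion_isAncestral _ _ _, hD'.2, fun v hv => DAG.insertion_parents_of_notMem hv⟩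
  refine (DAG.dagoid_insertion_congr_right (Quotient.out_eq (complete A)) _ h.symm).trans ?_
  rw [DAG.insertion_induce]
  exact hD.1

end Dagoid

/-! ### Likelihoods of a compatible family -/

section Distributions

open scoped ENNReal

variable {V : Type u} {𝓧 : V → Type w} [∀ v, MeasurableSpace (𝓧 v)]

/-- Under `θ`, the kernel `κ` applied to `X_C` is the conditional distribution of `X_v` given
`X_S`. -/
def HasTransition (θ : Measure (∀ v, 𝓧 v)) (S C : Set V) (v : V)
    (κ : Kernel (∀ a : C, 𝓧 a) (𝓧 v)) : Prop :=
  ∀ B : Set (𝓧 v), MeasurableSet B →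
    (θ.restrict ((fun x => x v) ⁻¹' B)).map S.domRestrict =
      (θ.withDensity fun x => κ (C.domRestrict x) B).map S.domRestrict

lemma measurable_domRestrict (S : Set V) : Measurable (S.domRestrict (π := 𝓧)) :=
  measurable_pi_lambda _ fun a => measurable_pi_apply (a : V)

lemma IsCondVersion.lintegral_eq {θ : Measure (∀ v, 𝓧 v)} [IsFiniteMeasure θ] {C : Set V} {v : V}
    {κ : Kernel (∀ a : C, 𝓧 a) (𝓧 v)} (h : IsCondVersion θ C v κ) {T : Set (∀ a : C, 𝓧 a)}
    (hT : MeasurableSet T) {B : Set (𝓧 v)} (hB : MeasurableSet B) :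
    ∫⁻ x in C.domRestrict ⁻¹' T, κ (C.domRestrict x) B ∂θ =
      θ ((fun x => x v) ⁻¹' B ∩ C.domRestrict ⁻¹' T) := by
  have := h.1
  have hC := measurable_domRestrict (𝓧 := 𝓧) C
  have h₁ := congrArg (fun μ => μ (T ×ˢ B)) h.2
  beta_reduce at h₁
  rw [Measure.compProd_apply_prod hT hB, setLIntegral_map hT (κ.measurable_coe hB) hC,
    Measure.map_apply (hC.prodMk (measurable_pi_apply v)) (hT.prod hB)] at h₁
  rw [h₁, Set.inter_comm]
  rfl

/-- If `E` and `F` are conditionally independent given `m`, and `k` is a version of the conditional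
probability of `E` given `m`, then the conditional probability of `E` given `F` can be computed
from `k`. -/
lemma measure_inter_eq_setLIntegral_of_condIndep {Ω : Type*} {m mΩ : MeasurableSpace Ω}
    (hm : m ≤ mΩ) {μ : Measure Ω} [IsFiniteMeasure μ] {E F : Set Ω} (hE : MeasurableSet E)
    (hF : MeasurableSet F) {k : Ω → ℝ≥0∞} (hk : Measurable[m] k) (hk1 : ∀ x, k x ≤ 1)
    (hkE : ∀ G, MeasurableSet[m] G → ∫⁻ x in G, k x ∂μ = μ (E ∩ G))
    (h : μ⟦E ∩ F | m⟧ =ᵐ[μ] μ⟦E | m⟧ * μ⟦F | m⟧) :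
    μ (E ∩ F) = ∫⁻ x in F, k x ∂μ := by
  have hkm : StronglyMeasurable[m] fun x => (k x).toReal :=
    hk.ennreal_toReal.stronglyMeasurable
  have hkint : Integrable (fun x => (k x).toReal) μ := by
    refine Integrable.of_bound (hkm.mono hm).aestronglyMeasurable 1 (ae_of_all _ fun x => ?_)
    rw [Real.norm_of_nonneg ENNReal.toReal_nonneg]
    exact ENNReal.toReal_mono ENNReal.one_ne_top (hk1 x)
  have hset : ∀ G : Set Ω, ∫ x in G, (k x).toReal ∂μ = (∫⁻ x in G, k x ∂μ).toReal := fun G =>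
    integral_toReal (hk.mono hm le_rfl).aemeasurable
      (ae_of_all _ fun x => (hk1 x).trans_lt ENNReal.one_lt_top)
  have hcond : μ⟦E | m⟧ =ᵐ[μ] fun x => (k x).toReal := by
    refine (ae_eq_condExp_of_forall_setIntegral_eq hm ((integrable_const (1 : ℝ)).indicator hE)
      (fun G _ _ => hkint.integrableOn) (fun G hG _ => ?_) hkm.aestronglyMeasurable).symm
    rw [hset, hkE G hG, integral_indicator hE, setIntegral_const,
      Measure.real, Measure.restrict_apply hE, smul_eq_mul, mul_one]
  have hFint : Integrable (F.indicator fun _ => (1 : ℝ)) μ := (integrable_const 1).indicator hF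
  have hkF : (fun x => (k x).toReal) * (F.indicator fun _ => (1 : ℝ)) =
      F.indicator fun x => (k x).toReal := by
    ext x
    by_cases hx : x ∈ F <;> simp [hx]
  -- As `k` is `m`-measurable, E[1_E 1_F | m] = k E[1_F | m] = E[k 1_F | m]; integrate over the
  -- whole space.
  have h₂ : μ⟦E ∩ F | m⟧ =ᵐ[μ] μ[F.indicator fun x => (k x).toReal | m] := by
    rw [← hkF]
    refine h.trans ((hcond.mul (ae_eq_refl _)).trans ?_)
    exact (condExp_mul_of_stronglyMeasurable_left hkm (hkF ▸ hkint.indicator hF) hFint).symm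
  have h₃ := integral_congr_ae h₂
  rw [integral_condExp hm, integral_condExp hm, integral_indicator hF,
    integral_indicator (hE.inter hF), setIntegral_const, smul_eq_mul, mul_one, hset] at h₃
  refine (ENNReal.toReal_eq_toReal_iff' (measure_ne_top _ _) ?_).1 h₃
  refine ne_top_of_le_ne_top (measure_ne_top μ F) ((lintegral_mono hk1).trans ?_)
  simp

lemma CondIndepCoord.hasTransition {θ : Measure (∀ v, 𝓧 v)} [IsFiniteMeasure θ] {S C : Set V}
    {v : V} {κ : Kernel (∀ a : C, 𝓧 a) (𝓧 v)} (hind : CondIndepCoord θ {v} S C)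
    (hκ : IsCondVersion θ C v κ) : HasTransition θ S C v κ := by
  intro B hB
  have := hκ.1
  have hS := measurable_domRestrict (𝓧 := 𝓧) S
  have hE : MeasurableSet ((fun x : ∀ v, 𝓧 v => x v) ⁻¹' B) := measurable_pi_apply v hB
  ext T hT
  rw [Measure.map_apply hS hT, Measure.map_apply hS hT, Measure.restrict_apply (hS hT),
    withDensity_apply _ (hS hT), Set.inter_comm]
  refine measure_inter_eq_setLIntegral_of_condIndep (measurable_domRestrict C).comap_le hE (hS hT)
    ((κ.measurable_coe hB).comp (comap_measurable _)) (fun x => prob_le_one) ?_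
    (hind ((fun y => y ⟨v, rfl⟩) ⁻¹' B) T (measurable_pi_apply _ hB) hT)
  rintro _ ⟨U, hU, rfl⟩
  exact hκ.lintegral_eq hU hB

/-- Both sides are linear in the measure. This serves the unnormalized sum of two members, which
dominates both. -/
lemma HasTransition.add {θ θ' : Measure (∀ v, 𝓧 v)} {S C : Set V} {v : V}
    {κ : Kernel (∀ a : C, 𝓧 a) (𝓧 v)} (h : HasTransition θ S C v κ)
    (h' : HasTransition θ' S C v κ) : HasTransition (θ + θ') S C v κ := by
  intro B hB
  have hS := measurable_domRestrict (𝓧 := 𝓧) S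
  rw [Measure.restrict_add, Measure.map_add _ _ hS, withDensity_add_measure,
    Measure.map_add _ _ hS, h B hB, h' B hB]

/-- If the law of `X_S` under `θ` has a density with respect to its law under `ρ` which depends on
`X_A` only, then so has the law of `(X_S, X_v)`. -/
lemma HasTransition.map_prod_eq {θ ρ : Measure (∀ v, 𝓧 v)} [IsFiniteMeasure θ]
    {S C A : Set V} {v : V} {κ : Kernel (∀ a : C, 𝓧 a) (𝓧 v)}
    (hθ : HasTransition θ S C v κ) (hρ : HasTransition ρ S C v κ) (hCS : C ⊆ S) (hAS : A ⊆ S)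
    {g : (∀ a : A, 𝓧 a) → ℝ≥0∞} (hg : Measurable g)
    (h : θ.map S.domRestrict = (ρ.withDensity (g ∘ A.domRestrict)).map S.domRestrict) :
    θ.map (fun x => (S.domRestrict x, x v)) =
      (ρ.withDensity (g ∘ A.domRestrict)).map (fun x => (S.domRestrict x, x v)) := by
  have hS := measurable_domRestrict (𝓧 := 𝓧) S
  have hA := measurable_domRestrict (𝓧 := 𝓧) A
  have hC := measurable_domRestrict (𝓧 := 𝓧) C
  have hSv : Measurable (fun x : ∀ v, 𝓧 v => (S.domRestrict x, x v)) :=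
    hS.prodMk (measurable_pi_apply v)
  let pA : (∀ a : S, 𝓧 a) → ∀ a : A, 𝓧 a := fun y a => y ⟨a, hAS a.2⟩
  let pC : (∀ a : S, 𝓧 a) → ∀ a : C, 𝓧 a := fun y a => y ⟨a, hCS a.2⟩
  have hpA : Measurable pA := measurable_pi_lambda _ fun a => measurable_pi_apply _
  have hpC : Measurable pC := measurable_pi_lambda _ fun a => measurable_pi_apply _
  have hgA : Measurable (g ∘ A.domRestrict : (∀ v, 𝓧 v) → ℝ≥0∞) := hg.comp hA
  have hgS : Measurable fun y => g (pA y) := hg.comp hpA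
  refine Measure.ext_prod fun {T B} hT hB => ?_
  have hκS : Measurable fun y => κ (pC y) B := (κ.measurable_coe hB).comp hpC
  have hκC : Measurable fun x : ∀ v, 𝓧 v => κ (C.domRestrict x) B := (κ.measurable_coe hB).comp hC
  have hgA' : Measurable fun x : ∀ v, 𝓧 v => g (pA (S.domRestrict x)) := hgS.comp hS
  set F : Set (∀ v, 𝓧 v) := S.domRestrict ⁻¹' T with hFdef
  set E : Set (∀ v, 𝓧 v) := (fun x => x v) ⁻¹' B with hEdef
  have hF : MeasurableSet F := hS hT
  have hE : MeasurableSet E := measurable_pi_apply v hB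
  rw [Measure.map_apply hSv (hT.prod hB), Measure.map_apply hSv (hT.prod hB)]
  change θ (F ∩ E) = ρ.withDensity _ (F ∩ E)
  calc θ (F ∩ E)
      = (θ.restrict E).map S.domRestrict T := by
        rw [Measure.map_apply hS hT, Measure.restrict_apply hF]
    _ = ∫⁻ x in F, κ (pC (S.domRestrict x)) B ∂θ := by
        rw [hθ B hB, Measure.map_apply hS hT, withDensity_apply _ hF]
        rfl
    _ = ∫⁻ y in T, κ (pC y) B ∂(θ.map S.domRestrict) := (setLIntegral_map hT hκS hS).symm
    _ = ∫⁻ x in F, κ (C.domRestrict x) B ∂(ρ.withDensity (g ∘ A.domRestrict)) := by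
        rw [h, setLIntegral_map hT hκS hS]
        rfl
    -- Both `g` and `κ` are functions of `X_S`, so the two densities can be exchanged.
    _ = ∫⁻ x in F, g (pA (S.domRestrict x)) ∂(ρ.withDensity fun x => κ (C.domRestrict x) B) := by
        rw [setLIntegral_withDensity_eq_setLIntegral_mul _ hgA hκC hF,
          setLIntegral_withDensity_eq_setLIntegral_mul _ hκC hgA' hF]
        exact lintegral_congr fun x => mul_comm _ _
    _ = ∫⁻ y in T, g (pA y) ∂((ρ.restrict E).map S.domRestrict) := by
        rw [hρ B hB, setLIntegral_map hT hgS hS]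
    _ = ∫⁻ x in F, g (A.domRestrict x) ∂(ρ.restrict E) := by
        rw [setLIntegral_map hT hgS hS]
        rfl
    _ = ρ.withDensity (g ∘ A.domRestrict) (F ∩ E) := by
        rw [Measure.restrict_restrict hF, withDensity_apply _ (hF.inter hE)]
        rfl

lemma map_insert_eq_of_map_prod_eq {μ ν : Measure (∀ v, 𝓧 v)} {S : Set V} {v : V}
    (h : μ.map (fun x => (S.domRestrict x, x v)) = ν.map (fun x => (S.domRestrict x, x v))) :
    μ.map (insert v S).domRestrict = ν.map (insert v S).domRestrict := by
  classical
  let φ : (∀ a : S, 𝓧 a) × 𝓧 v → ∀ a : ↥(insert v S), 𝓧 a := fun p a =>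
    if ha : v = (a : V) then ha ▸ p.2 else p.1 ⟨a, a.2.resolve_left (Ne.symm ha)⟩
  have hφ : Measurable φ := by
    refine measurable_pi_lambda _ fun ⟨a, ha⟩ => ?_
    by_cases hav : v = a
    · subst hav
      simpa [φ] using measurable_snd
    · simp only [φ, hav, dif_neg, not_false_eq_true]
      exact (measurable_pi_apply _).comp measurable_fst
  have hSv : Measurable (fun x : ∀ v, 𝓧 v => (S.domRestrict x, x v)) :=
    (measurable_domRestrict S).prodMk (measurable_pi_apply v)
  have hcomp : (insert v S).domRestrict = φ ∘ fun x : ∀ v, 𝓧 v => (S.domRestrict x, x v) := by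
    funext x ⟨a, ha⟩
    by_cases hav : v = a
    · subst hav
      simp [φ]
    · simp [φ, hav]
  rw [hcomp, ← Measure.map_map hφ hSv, ← Measure.map_map hφ hSv, h]

/-- The highest-ranked vertex of `S \ A` has no child in `S`, so removing it leaves an ancestral
set. -/
lemma DAG.IsAncestral.induction_on [Finite V] {G : DAG V} {A : Set V} (hA : G.IsAncestral A)
    {p : Set V → Prop} (base : p A)
    (step : ∀ S v, A ⊆ S → G.IsAncestral S → v ∉ S → G.parents v ⊆ S → p S → p (insert v S))
    {S : Set V} (hAS : A ⊆ S) (hS : G.IsAncestral S) : p S := by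
  obtain ⟨f, -, hf, -⟩ := DAG.exists_rank hA
  induction hn : (S \ A).ncard generalizing S with
  | zero =>
    rw [Set.ncard_eq_zero (Set.toFinite _), Set.sdiff_eq_empty] at hn
    rwa [hn.antisymm hAS]
  | succ n ih =>
    obtain ⟨v, hv, hmax⟩ := Set.exists_max_image (S \ A) f (Set.toFinite _)
      (Set.nonempty_of_ncard_ne_zero (by omega))
    have hAS' : A ⊆ S \ {v} := Set.subset_sdiff_singleton hAS hv.2
    have hS' : G.IsAncestral (S \ {v}) := by
      refine fun u hu a ha => ⟨hS u hu.1 ha, ?_⟩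
      rintro rfl
      by_cases huA : u ∈ A
      · exact hv.2 (hA u huA ha)
      · exact absurd (hmax u ⟨hu.1, huA⟩) (not_le.2 (hf _ _ ha))
    have hp : p (S \ {v}) := by
      refine ih hAS' hS' ?_
      rw [sdiff_right_comm, Set.ncard_sdiff_singleton_of_mem hv, hn]
      rfl
    have := step _ v hAS' hS' (fun h => h.2 rfl) (fun a ha => ⟨hS v hv.1 ha, ?_⟩) hp
    · rwa [Set.insert_sdiff_singleton, Set.insert_eq_of_mem hv.1] at this
    · rintro rfl
      exact lt_irrefl _ (hf _ _ ha)

lemma CompatibleFamily.exists_hasTransition {θ : Dagoid V → ProbabilityMeasure (∀ v, 𝓧 v)}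
    (hθ : CompatibleFamily θ) {D D' : Dagoid V} {G G' : DAG V} (hG : G ∈ D) (hG' : G' ∈ D')
    {v : V} (hv : G.parents v = G'.parents v) {S : Set V} (hS : G.IsAncestral S)
    (hS' : G'.IsAncestral S) (hvS : v ∉ S) (hpS : G.parents v ⊆ S) :
    ∃ κ, HasTransition (θ D : Measure (∀ v, 𝓧 v)) S (G.parents v) v κ ∧
      HasTransition (θ D' : Measure (∀ v, 𝓧 v)) S (G.parents v) v κ := by
  obtain ⟨κ, hκ, hκ'⟩ := hθ.compatible D D' G hG G' hG' v hv
  refine ⟨κ, CondIndepCoord.hasTransition ?_ hκ, CondIndepCoord.hasTransition ?_ hκ'⟩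
  · refine hθ.isMarkov D _ _ _ ?_
    obtain rfl : G.dagoid = D := hG
    exact (DAG.splits_of_isAncestral hS hvS hpS).mem_semigraphoid
  · refine hθ.isMarkov D' _ _ _ ?_
    obtain rfl : G'.dagoid = D' := hG'
    rw [hv] at hpS ⊢
    exact (DAG.splits_of_isAncestral hS' hvS hpS).mem_semigraphoid

/-- Chain rule from `∅` up to `A`, with density 1: representatives with equal parents inside `A`
share a kernel at each step. -/
lemma CompatibleFamily.map_eq_of_induced_eq [Finite V]
    {θ : Dagoid V → ProbabilityMeasure (∀ v, 𝓧 v)} (hθ : CompatibleFamily θ) {A : Set V}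
    {D D' : Dagoid.ances A} (h : Dagoid.induced A D = Dagoid.induced A D') :
    (θ D : Measure (∀ v, 𝓧 v)).map A.domRestrict =
      (θ D' : Measure (∀ v, 𝓧 v)).map A.domRestrict := by
  obtain ⟨G, hG, G', hG', hA, hpar⟩ := Dagoid.exists_parents_eq_of_induced_eq D D' h
  have hempty : G.IsAncestral ∅ := fun v hv => hv.elim
  refine hempty.induction_on (p := fun S => S ⊆ A → (θ D : Measure (∀ v, 𝓧 v)).map S.domRestrict =
    (θ D' : Measure (∀ v, 𝓧 v)).map S.domRestrict) ?_ ?_ (Set.empty_subset A) hA subset_rfl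
  · intro _
    have hm := measurable_domRestrict (𝓧 := 𝓧) ∅
    ext T hT
    rcases T.eq_empty_or_nonempty with rfl | hne
    · simp
    · rw [Subsingleton.eq_univ_of_nonempty hne, Measure.map_apply hm .univ,
        Measure.map_apply hm .univ]
      simp
  · intro S v _ hS hvS hpS ih hins
    have hv : v ∈ A := hins (Set.mem_insert _ _)
    have hSA : S ⊆ A := (Set.subset_insert _ _).trans hins
    have hS' : G'.IsAncestral S := fun u hu => hpar u (hSA hu) ▸ hS u hu
    obtain ⟨κ, hκ, hκ'⟩ := hθ.exists_hasTransition hG hG' (hpar v hv) hS hS' hvS hpS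
    have hone : (θ D' : Measure (∀ v, 𝓧 v)).withDensity
        ((fun _ => 1) ∘ (∅ : Set V).domRestrict) = (θ D' : Measure (∀ v, 𝓧 v)) :=
      withDensity_one
    have := hκ.map_prod_eq hκ' hpS (Set.empty_subset S) (g := fun _ => 1) measurable_const
      (by rw [hone]; exact ih hSA)
    rw [hone] at this
    exact map_insert_eq_of_map_prod_eq this

/-- Chain rule from `A` up to `V`: the density is set by the laws of `X_A`, and the shared kernels
outside `A` never change it. The sum is the reference measure because neither law need dominate the
other. -/
lemma CompatibleFamily.eq_withDensity_of_remainder_eq [Finite V]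
    {θ : Dagoid V → ProbabilityMeasure (∀ v, 𝓧 v)} (hθ : CompatibleFamily θ) {A : Set V}
    {D D' : Dagoid.ances A} (h : Dagoid.remainder A D = Dagoid.remainder A D')
    {μ μ' : Measure (∀ a : A, 𝓧 a)}
    (hμ : (θ D : Measure (∀ v, 𝓧 v)).map A.domRestrict = μ)
    (hμ' : (θ D' : Measure (∀ v, 𝓧 v)).map A.domRestrict = μ') :
    (θ D : Measure (∀ v, 𝓧 v)) =
      ((θ D : Measure (∀ v, 𝓧 v)) + (θ D' : Measure (∀ v, 𝓧 v))).withDensity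
        (μ.rnDeriv (μ + μ') ∘ A.domRestrict) := by
  obtain ⟨G, hG, G', hG', hA, hA', hpar⟩ := Dagoid.exists_parents_eq_of_remainder_eq D D' h
  have hm := measurable_domRestrict (𝓧 := 𝓧) A
  have hfin : IsFiniteMeasure μ := hμ ▸ inferInstance
  have hfin' : IsFiniteMeasure μ' := hμ' ▸ inferInstance
  have hg := Measure.measurable_rnDeriv μ (μ + μ')
  set g := μ.rnDeriv (μ + μ') with hgdef
  set ρ := (θ D : Measure (∀ v, 𝓧 v)) + (θ D' : Measure (∀ v, 𝓧 v)) with hρdef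
  have hρ : ρ.map A.domRestrict = μ + μ' := by rw [hρdef, Measure.map_add _ _ hm, hμ, hμ']
  have key : (θ D : Measure (∀ v, 𝓧 v)).map (Set.univ : Set V).domRestrict =
      (ρ.withDensity (g ∘ A.domRestrict)).map (Set.univ : Set V).domRestrict := by
    have hstep := hA.induction_on (S := Set.univ) (p := fun S => G'.IsAncestral S ∧
      (θ D : Measure (∀ v, 𝓧 v)).map S.domRestrict =
        (ρ.withDensity (g ∘ A.domRestrict)).map S.domRestrict) ?_ ?_ (Set.subset_univ A)
        (fun _ _ => Set.subset_univ _)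
    · exact hstep.2
    · refine ⟨hA', ?_⟩
      ext T hT
      rw [Measure.map_apply hm hT, Measure.map_apply hm hT, withDensity_apply _ (hm hT)]
      simp only [Function.comp_apply]
      rw [← setLIntegral_map hT hg hm, hρ, hgdef, Measure.setLIntegral_rnDeriv
        (Measure.absolutelyContinuous_of_le (Measure.le_add_right le_rfl)), ← hμ,
        Measure.map_apply hm hT]
    · rintro S v hAS hS hvS hpS ⟨hS', ih⟩
      have hv : G.parents v = G'.parents v := hpar v fun h => hvS (hAS h)
      obtain ⟨κ, hκ, hκ'⟩ := hθ.exists_hasTransition hG hG' hv hS hS' hvS hpS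
      refine ⟨?_, map_insert_eq_of_map_prod_eq (hκ.map_prod_eq (hκ.add hκ') hpS hAS hg ih)⟩
      rintro u (rfl | hu)
      · exact (hv ▸ hpS).trans (Set.subset_insert _ _)
      · exact (hS' u hu).trans (Set.subset_insert _ _)
  have hu := measurable_domRestrict (𝓧 := 𝓧) Set.univ
  let e : (∀ a : (Set.univ : Set V), 𝓧 a) → ∀ v, 𝓧 v := fun y v => y ⟨v, trivial⟩
  have he : Measurable e := measurable_pi_lambda _ fun v => measurable_pi_apply _
  have hid : e ∘ (Set.univ : Set V).domRestrict = (id : (∀ v, 𝓧 v) → ∀ v, 𝓧 v) := rfl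
  have := congrArg (Measure.map e) key
  rwa [Measure.map_map he hu, Measure.map_map he hu, hid, Measure.map_id, Measure.map_id] at this

/-- The densities of a compatible family factorize into functions of the remainder and of the
induced subdagoid. -/
lemma CompatibleFamily.ae_rnDeriv_mul_eq [Finite V]
    {θ : Dagoid V → ProbabilityMeasure (∀ v, 𝓧 v)} (hθ : CompatibleFamily θ)
    (m : Measure (∀ v, 𝓧 v)) [SigmaFinite m] {A : Set V} {D₁ D₂ D₃ D₄ : Dagoid.ances A}
    (h₁₃ : Dagoid.remainder A D₁ = Dagoid.remainder A D₃)
    (h₂₄ : Dagoid.remainder A D₂ = Dagoid.remainder A D₄)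
    (h₁₄ : Dagoid.induced A D₁ = Dagoid.induced A D₄)
    (h₂₃ : Dagoid.induced A D₂ = Dagoid.induced A D₃) :
    ∀ᵐ x ∂m, (θ D₁ : Measure (∀ v, 𝓧 v)).rnDeriv m x * (θ D₂ : Measure (∀ v, 𝓧 v)).rnDeriv m x =
      (θ D₃ : Measure (∀ v, 𝓧 v)).rnDeriv m x * (θ D₄ : Measure (∀ v, 𝓧 v)).rnDeriv m x := by
  have hA := measurable_domRestrict (𝓧 := 𝓧) A
  have key : ∀ {D D' : Dagoid.ances A} {μ μ' : Measure (∀ a : A, 𝓧 a)},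
      Dagoid.remainder A D = Dagoid.remainder A D' →
      (θ D : Measure (∀ v, 𝓧 v)).map A.domRestrict = μ →
      (θ D' : Measure (∀ v, 𝓧 v)).map A.domRestrict = μ' →
      (θ D : Measure (∀ v, 𝓧 v)).rnDeriv m =ᵐ[m] fun x => μ.rnDeriv (μ + μ') (A.domRestrict x) *
        ((θ D : Measure (∀ v, 𝓧 v)) + (θ D' : Measure (∀ v, 𝓧 v))).rnDeriv m x := by
    intro D D' μ μ' h hμ hμ'
    have hfin : IsFiniteMeasure μ := hμ ▸ inferInstance
    conv_lhs => rw [hθ.eq_withDensity_of_remainder_eq h hμ hμ']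
    refine Measure.rnDeriv_withDensity_left
      ((Measure.measurable_rnDeriv _ _).comp hA).aemeasurable ?_
    refine ae_of_ae_map hA.aemeasurable (p := fun y => μ.rnDeriv (μ + μ') y ≠ ∞) ?_
    rw [Measure.map_add _ _ hA, hμ, hμ']
    exact Measure.rnDeriv_ne_top _ _
  -- On `A`, D₂ has the law of D₃ and D₄ that of D₁, so only two functions r₁, r₃ of x_A occur: p₁ =
  -- r₁ρ₁₃, p₃ = r₃ρ₁₃, p₂ = r₃ρ₂₄, p₄ = r₁ρ₂₄, where ρᵢⱼ is the density of the sum.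
  have e₁ := key h₁₃ rfl rfl
  have e₃ := key h₁₃.symm rfl rfl
  have e₂ := key h₂₄ (hθ.map_eq_of_induced_eq h₂₃) (hθ.map_eq_of_induced_eq h₁₄).symm
  have e₄ := key h₂₄.symm (hθ.map_eq_of_induced_eq h₁₄).symm (hθ.map_eq_of_induced_eq h₂₃)
  rw [add_comm (θ D₃ : Measure (∀ v, 𝓧 v))] at e₃
  rw [add_comm (θ D₄ : Measure (∀ v, 𝓧 v))] at e₄
  filter_upwards [e₁, e₂, e₃, e₄] with x x₁ x₂ x₃ x₄
  rw [x₁, x₂, x₃, x₄]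
  ring

end Distributions

/-! ### Independence as a cross-product identity -/

section Independence

open scoped ENNReal

variable {Ω α β : Type*} [MeasurableSpace Ω] {ν : Measure Ω} {f : Ω → α} {g : Ω → β}

/-- The cross-product form of independence of two discrete variables, for a measure which is not
normalized. -/
def CrossIndep (ν : Measure Ω) (f : Ω → α) (g : Ω → β) : Prop :=
  ∀ a a' b b', ν (f ⁻¹' {a} ∩ g ⁻¹' {b}) * ν (f ⁻¹' {a'} ∩ g ⁻¹' {b'}) =
    ν (f ⁻¹' {a} ∩ g ⁻¹' {b'}) * ν (f ⁻¹' {a'} ∩ g ⁻¹' {b})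

lemma CrossIndep.withDensity (h : CrossIndep ν f g) {φ : Ω → ℝ≥0∞}
    [DiscreteMeasurableSpace Ω]
    (hφ : ∀ ω₁ ω₂ ω₃ ω₄, f ω₁ = f ω₃ → f ω₂ = f ω₄ → g ω₁ = g ω₄ → g ω₂ = g ω₃ →
      φ ω₁ * φ ω₂ = φ ω₃ * φ ω₄) :
    CrossIndep (ν.withDensity φ) f g := by
  -- `hφ` with ω₁ = ω₂ and ω₃ = ω₄ compares squares, so `φ` is constant on each cell.
  have hcongr : ∀ ω ω', f ω = f ω' → g ω = g ω' → φ ω = φ ω' := by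
    intro ω ω' hf hg
    have := hφ ω ω ω' ω' hf hf hg hg
    simp only [← sq] at this
    exact (ENNReal.pow_right_strictMono two_ne_zero).injective this
  have hcell : ∀ ω, ν.withDensity φ (f ⁻¹' {f ω} ∩ g ⁻¹' {g ω}) =
      φ ω * ν (f ⁻¹' {f ω} ∩ g ⁻¹' {g ω}) := by
    intro ω
    rw [withDensity_apply _ (.of_discrete), ← setLIntegral_const]
    refine setLIntegral_congr_fun .of_discrete fun ω' hω' => hcongr _ _ hω'.1 hω'.2
  have hzero : ∀ {s}, ν s = 0 → ν.withDensity φ s = 0 := fun hs =>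
    withDensity_absolutelyContinuous ν φ hs
  intro a a' b b'
  have hab := h a a' b b'
  -- Empty cells offer no point at which to apply `hφ`; they are null, and null cells stay null.
  by_cases h0 : ν (f ⁻¹' {a} ∩ g ⁻¹' {b}) * ν (f ⁻¹' {a'} ∩ g ⁻¹' {b'}) = 0
  · have h0' := hab ▸ h0
    rw [mul_eq_zero] at h0 h0'
    rw [mul_eq_zero.2 (h0.imp hzero hzero), mul_eq_zero.2 (h0'.imp hzero hzero)]
  · have h0' := hab ▸ h0
    obtain ⟨ω₁, rfl, rfl⟩ := nonempty_of_measure_ne_zero (left_ne_zero_of_mul h0)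
    obtain ⟨ω₂, rfl, rfl⟩ := nonempty_of_measure_ne_zero (right_ne_zero_of_mul h0)
    obtain ⟨ω₃, h₃, h₃'⟩ := nonempty_of_measure_ne_zero (left_ne_zero_of_mul h0')
    obtain ⟨ω₄, h₄, h₄'⟩ := nonempty_of_measure_ne_zero (right_ne_zero_of_mul h0')
    simp only [Set.mem_preimage, Set.mem_singleton_iff] at h₃ h₃' h₄ h₄'
    have e₃ := hcell ω₃
    have e₄ := hcell ω₄
    rw [h₃, h₃'] at e₃
    rw [h₄, h₄'] at e₄
    rw [hcell ω₁, hcell ω₂, e₃, e₄, mul_mul_mul_comm, hab,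
      hφ ω₁ ω₂ ω₃ ω₄ h₃.symm h₄.symm h₄'.symm h₃'.symm, mul_mul_mul_comm]

variable [MeasurableSpace α] [MeasurableSpace β]

lemma measure_inter_preimage_eq_sum [MeasurableSingletonClass α] [MeasurableSingletonClass β]
    (hf : Measurable f) (hg : Measurable g) (S : Finset α) (T : Finset β) :
    ν (f ⁻¹' S ∩ g ⁻¹' T) = ∑ a ∈ S, ∑ b ∈ T, ν (f ⁻¹' {a} ∩ g ⁻¹' {b}) := by
  have h : f ⁻¹' S ∩ g ⁻¹' T = (fun ω => (f ω, g ω)) ⁻¹' ↑(S ×ˢ T) := by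
    ext; simp
  rw [h, ← sum_measure_preimage_singleton _ fun p _ => (hf.prodMk hg) (measurableSet_singleton p),
    Finset.sum_product]
  refine Finset.sum_congr rfl fun a _ => Finset.sum_congr rfl fun b _ => congrArg ν ?_
  ext; simp

lemma CrossIndep.measure_inter_mul [MeasurableSingletonClass α] [MeasurableSingletonClass β]
    (h : CrossIndep ν f g) (hf : Measurable f) (hg : Measurable g) (S S' : Finset α)
    (T T' : Finset β) :
    ν (f ⁻¹' S ∩ g ⁻¹' T) * ν (f ⁻¹' S' ∩ g ⁻¹' T') =
      ν (f ⁻¹' S ∩ g ⁻¹' T') * ν (f ⁻¹' S' ∩ g ⁻¹' T) := by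
  simp only [measure_inter_preimage_eq_sum hf hg, Finset.sum_mul_sum]
  refine Finset.sum_congr rfl fun a _ => Finset.sum_congr rfl fun a' _ => ?_
  rw [Finset.sum_comm]
  exact Finset.sum_congr rfl fun b' _ => Finset.sum_congr rfl fun b _ => h a a' b b'

lemma indepFun_smul_iff_crossIndep [Finite α] [Finite β] [MeasurableSingletonClass α]
    [MeasurableSingletonClass β] [IsFiniteMeasure ν] (hf : Measurable f) (hg : Measurable g) :
    IndepFun f g ((ν Set.univ)⁻¹ • ν) ↔ CrossIndep ν f g := by
  rw [indepFun_iff_measure_inter_preimage_eq_mul]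
  simp only [Measure.smul_apply, smul_eq_mul]
  -- Here the scalar is ⊤, but ⊤ • 0 = 0; this covers a null conditioning event.
  by_cases h0 : ν Set.univ = 0
  · rw [Measure.measure_univ_eq_zero] at h0
    subst h0
    simp [CrossIndep]
  have htop : ν Set.univ ≠ ∞ := measure_ne_top _ _
  set c := ν Set.univ with hc
  have hcc : c * c⁻¹ = 1 := ENNReal.mul_inv_cancel h0 htop
  constructor
  · intro h
    have key : ∀ a b, ν (f ⁻¹' {a} ∩ g ⁻¹' {b}) = c⁻¹ * (ν (f ⁻¹' {a}) * ν (g ⁻¹' {b})) := by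
      intro a b
      have h₁ := congrArg (c * ·) (h {a} {b} (measurableSet_singleton a) (measurableSet_singleton b))
      simp only [← mul_assoc, hcc, one_mul] at h₁
      rw [h₁]
      ring
    intro a a' b b'
    simp only [key]
    ring
  · intro h s t _ _
    classical
    have := Fintype.ofFinite α
    have := Fintype.ofFinite β
    -- Summing over all a' and b' gives ν(s ∩ t) ν(Ω) = ν(s) ν(t).
    have h₁ := h.measure_inter_mul hf hg s.toFinset Finset.univ t.toFinset Finset.univ
    simp only [Set.coe_toFinset, Finset.coe_univ, Set.preimage_univ, Set.inter_univ,
      Set.univ_inter, ← hc] at h₁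
    calc c⁻¹ * ν (f ⁻¹' s ∩ g ⁻¹' t)
        = c⁻¹ * ν (f ⁻¹' s ∩ g ⁻¹' t) * (c * c⁻¹) := by rw [hcc, mul_one]
      _ = c⁻¹ * c⁻¹ * (ν (f ⁻¹' s ∩ g ⁻¹' t) * c) := by ring
      _ = c⁻¹ * ν (f ⁻¹' s) * (c⁻¹ * ν (g ⁻¹' t)) := by rw [h₁]; ring

end Independence

/-! ### The posterior graph law -/

section Posterior

open scoped ENNReal

variable {V : Type u} {𝓧 : V → Type w} [∀ v, MeasurableSpace (𝓧 v)]

instance (A : Set V) : DiscreteMeasurableSpace (Dagoid.ances A) :=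
  ⟨fun s => ⟨Subtype.val '' s, .of_discrete, Set.preimage_image_eq _ Subtype.val_injective⟩⟩

lemma measurableEmbedding_ances (A : Set V) :
    MeasurableEmbedding (Subtype.val : Dagoid.ances A → Dagoid V) :=
  MeasurableEmbedding.subtype_coe .of_discrete

lemma structurallyMarkov_iff_crossIndep [Finite V] (π : Measure (Dagoid V)) [IsFiniteMeasure π] :
    StructurallyMarkov π ↔ ∀ A : Set V,
      CrossIndep (π.comap (Subtype.val : Dagoid.ances A → Dagoid V)) (Dagoid.remainder A)
        (Dagoid.induced A) := by
  refine forall_congr' fun A => ?_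
  have : IsFiniteMeasure (π.comap (Subtype.val : Dagoid.ances A → Dagoid V)) := ⟨by
    rw [(measurableEmbedding_ances A).comap_apply]
    exact measure_lt_top _ _⟩
  rw [← indepFun_smul_iff_crossIndep .of_discrete .of_discrete]
  congr! 1
  ext s -
  rw [(measurableEmbedding_ances A).comap_apply, Measure.smul_apply,
    (measurableEmbedding_ances A).comap_apply, (measurableEmbedding_ances A).comap_apply,
    cond_apply .of_discrete, Set.image_univ, Subtype.range_coe,
    Set.inter_eq_right.2 (Subtype.coe_image_subset _ _), smul_eq_mul]

lemma comap_withDensity_ances (π : Measure (Dagoid V)) (φ : Dagoid V → ℝ≥0∞) (A : Set V) :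
    (π.withDensity φ).comap (Subtype.val : Dagoid.ances A → Dagoid V) =
      (π.comap (Subtype.val : Dagoid.ances A → Dagoid V)).withDensity fun D => φ D := by
  ext s hs
  rw [(measurableEmbedding_ances A).comap_apply, withDensity_apply _ .of_discrete,
    withDensity_apply _ hs, setLIntegral_subtype .of_discrete]

end Posterior

end StructMarkov

theorem mainTheorem8 {V : Type*} [Finite V] {𝓧 : V → Type*} [∀ v, MeasurableSpace (𝓧 v)]
    (π : Measure (StructMarkov.Dagoid V)) [IsProbabilityMeasure π]
    (hπ : StructMarkov.StructurallyMarkov π)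
    (θ : StructMarkov.Dagoid V → ProbabilityMeasure (∀ v, 𝓧 v))
    (hθ : StructMarkov.CompatibleFamily θ) :
    ∀ᵐ x ∂(Measure.bind π (StructMarkov.samplingKernel θ)),
      StructMarkov.StructurallyMarkov
        (posterior (StructMarkov.samplingKernel θ) π x) := by
  open StructMarkov in
  rw [structurallyMarkov_iff_crossIndep] at hπ
  -- Bayes' formula: the posterior is `π` with the likelihood at `x` as density.
  have hpost := posterior_eq_withDensity_of_countable (samplingKernel θ) π
  have hfactor : ∀ᵐ x ∂(Measure.bind π (samplingKernel θ)),
      ∀ (A : Set V) (D₁ D₂ D₃ D₄ : Dagoid.ances A),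
        Dagoid.remainder A D₁ = Dagoid.remainder A D₃ →
        Dagoid.remainder A D₂ = Dagoid.remainder A D₄ →
        Dagoid.induced A D₁ = Dagoid.induced A D₄ →
        Dagoid.induced A D₂ = Dagoid.induced A D₃ →
        (samplingKernel θ D₁).rnDeriv (Measure.bind π (samplingKernel θ)) x *
            (samplingKernel θ D₂).rnDeriv (Measure.bind π (samplingKernel θ)) x =
          (samplingKernel θ D₃).rnDeriv (Measure.bind π (samplingKernel θ)) x *
            (samplingKernel θ D₄).rnDeriv (Measure.bind π (samplingKernel θ)) x := by
    -- There are finitely many sets and dagoids, so one null set serves them all.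
    simp only [ae_all_iff]
    intro A D₁ D₂ D₃ D₄ h₁₃ h₂₄ h₁₄ h₂₃
    exact hθ.ae_rnDeriv_mul_eq _ h₁₃ h₂₄ h₁₄ h₂₃
  filter_upwards [hpost, hfactor] with x hx hfx
  rw [structurallyMarkov_iff_crossIndep]
  intro A
  rw [hx, comap_withDensity_ances]
  exact (hπ A).withDensity (hfx A)
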